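/- Let $A$ and $B$ be (not necessarily unital) complex $C^*$-algebras, and let $\varphi\colon A\to B$ be a bounded, linear map. Say that a map $f\colon C\to D$ between $C^*$-algebras preserves - *zero-products* if $ab=0$ implies $f(a)f(b)=0$, for all $a,b\in C$; - *range-orthogonality* if $a^*b=0$ implies $f(a)^*f(b)=0$, for all $a,b\in C$; - *domain-orthogonality* if $ab^*=0$ implies $f(a)f(b)^*=0$, for all $a,b\in C$; - *zero-TRO-products* if $ab^*c=0$ implies $f(a)f(b)^*f(c)=0$, for all $a,b,c\in C$. For $n\geq 1$, let $\varphi^{(n)}\colon M_n(A)\to M_n(B)$, $\varphi^{(n)}\big((a_{ij})_{i,j}\big)=(\varphi(a_{ij}))_{i,j}$, be the amplification of $\varphi$ to the $C^*$-algebras of $n\times n$ matrices. If $\varphi$ preserves zero-products (respectively, range-orthogonality, domain-orthogonality, zero-TRO-products), then $\varphi^{(n)}$ preserves zero-products (respectively, range-orthogonality, domain-orthogonality, zero-TRO-products) for every $n\geq 1$. -/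

import Mathlib

/-- `f` preserves zero-products: `a b = 0` implies `f(a) f(b) = 0`. -/
def PreservesZeroProducts {A B : Type*} [NonUnitalSemiring A] [NonUnitalSemiring B]
    (f : A → B) : Prop :=
  ∀ a b : A, a * b = 0 → f a * f b = 0

/-- `f` preserves range-orthogonality: `a* b = 0` implies `f(a)* f(b) = 0`. -/
def PreservesRangeOrthogonality {A B : Type*} [NonUnitalSemiring A] [StarRing A]
    [NonUnitalSemiring B] [StarRing B] (f : A → B) : Prop :=
  ∀ a b : A, star a * b = 0 → star (f a) * f b = 0

/-- `f` preserves domain-orthogonality: `a b* = 0` implies `f(a) f(b)* = 0`. -/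
def PreservesDomainOrthogonality {A B : Type*} [NonUnitalSemiring A] [StarRing A]
    [NonUnitalSemiring B] [StarRing B] (f : A → B) : Prop :=
  ∀ a b : A, a * star b = 0 → f a * star (f b) = 0

/-- `f` preserves zero-TRO-products: `a b* c = 0` implies `f(a) f(b)* f(c) = 0`. -/
def PreservesZeroTROProducts {A B : Type*} [NonUnitalSemiring A] [StarRing A]
    [NonUnitalSemiring B] [StarRing B] (f : A → B) : Prop :=
  ∀ a b c : A, a * star b * c = 0 → f a * star (f b) * f c = 0

/-- The amplification `φ⁽ⁿ⁾ : Mₙ(A) → Mₙ(B)`, which applies `φ` to every matrix entry.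
`CStarMatrix (Fin n) (Fin n) A` is the C⋆-algebra `Mₙ(A)`: its product is matrix multiplication
and its involution is the conjugate transpose. -/
def amplification {A B : Type*} [NonUnitalCStarAlgebra A] [NonUnitalCStarAlgebra B]
    (φ : A →L[ℂ] B) (n : ℕ) :
    CStarMatrix (Fin n) (Fin n) A →ₗ[ℂ] CStarMatrix (Fin n) (Fin n) B :=
  CStarMatrix.mapₗ (φ : A →ₗ[ℂ] B)

/-!
A bounded bilinear map `V` on a C⋆-algebra that vanishes on zero-products is balanced:
`V (a * b) c = V a (b * c)`. By functional calculus in the unitization, this reduces to `D f 1 = 0`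
for a bounded alternating bilinear map `D` on `C(X, ℝ)` that vanishes on pairs of functions with
product zero. If `1 ≤ f`, slice `f` into ramps `r_k` of unit height and let
`h_k = r_k - r_{k+1}`. Because `r_j r_k = r_k` for `j < k`, one gets
`D r_{k+1} 1 = D h_{k+1} h_k`. The tents `h_{k+1}` and `h_j` are orthogonal for distinct `j` and `k`
congruent modulo `3`, so summing over a residue class gives a single value of `D` at functions of
norm at most `1`. Hence `‖D f 1‖ ≤ 3 ‖D‖` whatever the size of `f`, and rescaling `f` gives
`D f 1 = 0`.

Balancedness and an approximate unit `e` turn `∑ x_k y_k = 0` into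
`∑ V x_k y_k = lim ∑ V x_k (y_k e) = lim V (∑ x_k y_k) e = 0`, and the entries of a product of
matrices are such sums.
-/

open Filter Topology

section ContinuousFunctions

variable {X : Type*} [TopologicalSpace X]

/-- The part of `f` between the heights `k` and `k + 1`, shifted down to take values in `[0, 1]`:
it vanishes where `f ≤ k` and equals `1` where `f ≥ k + 1`.
The ramps slice `f` into layers of unit height. -/
noncomputable def ramp (f : C(X, ℝ)) (k : ℕ) : C(X, ℝ) :=
  f ⊓ ((k + 1 : ℕ) : C(X, ℝ)) - f ⊓ (k : C(X, ℝ))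

/-- The bump supported in `{k ≤ f ≤ k + 2}` cut out by two consecutive ramps; tents whose indices
differ by at least `2` are orthogonal. -/
noncomputable def tent (f : C(X, ℝ)) (k : ℕ) : C(X, ℝ) :=
  ramp f k - ramp f (k + 1)

theorem ramp_apply (f : C(X, ℝ)) (k : ℕ) (x : X) :
    ramp f k x = min (f x) (k + 1) - min (f x) k := by
  simp [ramp]

theorem ramp_nonneg (f : C(X, ℝ)) (k : ℕ) (x : X) : 0 ≤ ramp f k x := by
  rw [ramp_apply, sub_nonneg]
  gcongr
  linarith

theorem ramp_le_one (f : C(X, ℝ)) (k : ℕ) (x : X) : ramp f k x ≤ 1 := by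
  rw [ramp_apply]
  grind

theorem ramp_mul_ramp_of_lt (f : C(X, ℝ)) {j k : ℕ} (hjk : j < k) :
    ramp f j * ramp f k = ramp f k := by
  have hjk' : (j : ℝ) + 1 ≤ k := by exact_mod_cast hjk
  ext x
  rw [ContinuousMap.mul_apply, ramp_apply, ramp_apply]
  grind

theorem sum_ramp_succ {f : C(X, ℝ)} {n : ℕ} (hf : 1 ≤ f) (hfn : f ≤ ((n + 1 : ℕ) : C(X, ℝ))) :
    ∑ k ∈ Finset.range n, ramp f (k + 1) = f - 1 := by
  simp only [ramp]
  rw [Finset.sum_range_sub (fun k => f ⊓ ((k + 1 : ℕ) : C(X, ℝ))), inf_eq_left.2 hfn, zero_add,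
    Nat.cast_one, inf_eq_right.2 hf]

theorem tent_nonneg (f : C(X, ℝ)) (k : ℕ) (x : X) : 0 ≤ tent f k x := by
  rw [tent, ContinuousMap.sub_apply, sub_nonneg, ← ramp_mul_ramp_of_lt f k.lt_succ_self]
  exact mul_le_of_le_one_right (ramp_nonneg f k x) (ramp_le_one f (k + 1) x)

theorem tent_mul_tent_eq_zero (f : C(X, ℝ)) {j k : ℕ} (hjk : j + 2 ≤ k) :
    tent f j * tent f k = 0 := by
  simp only [tent, sub_mul, mul_sub]
  repeat rw [ramp_mul_ramp_of_lt f (by omega)]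
  simp

theorem norm_sum_tent_le_one [CompactSpace X] (f : C(X, ℝ)) (s : Finset ℕ) :
    ‖∑ k ∈ s, tent f k‖ ≤ 1 := by
  obtain ⟨n, hn⟩ := s.exists_nat_subset_range
  refine (ContinuousMap.norm_le _ zero_le_one).2 fun x => ?_
  rw [ContinuousMap.sum_apply, Real.norm_of_nonneg (Finset.sum_nonneg fun k _ => tent_nonneg f k x)]
  calc ∑ k ∈ s, tent f k x ≤ ∑ k ∈ Finset.range n, tent f k x :=
        Finset.sum_le_sum_of_subset_of_nonneg hn fun k _ _ => tent_nonneg f k x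
    _ = ramp f 0 x - ramp f n x := Finset.sum_range_sub' (fun k => ramp f k x) n
    _ ≤ 1 := by linarith [ramp_nonneg f n x, ramp_le_one f 0 x]

section Bilinear

variable {E : Type*} [AddCommGroup E] [Module ℝ E] {D : C(X, ℝ) →ₗ[ℝ] C(X, ℝ) →ₗ[ℝ] E}

theorem apply_ramp_succ_one (hD : ∀ f g, f * g = 0 → D f g = 0) (halt : ∀ f, D f f = 0)
    (f : C(X, ℝ)) (k : ℕ) :
    D (ramp f (k + 1)) 1 = D (tent f (k + 1)) (tent f k) := by
  have absorb {i j : ℕ} (hij : i < j) : D (ramp f j) (ramp f i) = D (ramp f j) 1 := by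
    refine (sub_eq_zero.1 ?_).symm
    rw [← map_sub]
    exact hD _ _ (by rw [mul_sub, mul_one, mul_comm, ramp_mul_ramp_of_lt f hij, sub_self])
  simp only [tent, map_sub, LinearMap.sub_apply]
  rw [halt, absorb (show k < k + 1 by omega), absorb (show k < k + 1 + 1 by omega),
    absorb (show k + 1 < k + 1 + 1 by omega)]
  abel

theorem apply_sum_sum_of_mul_eq_zero (hD : ∀ f g, f * g = 0 → D f g = 0) {ι : Type*}
    (s : Finset ι) (u v : ι → C(X, ℝ)) (huv : ∀ i ∈ s, ∀ j ∈ s, i ≠ j → u i * v j = 0) :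
    D (∑ i ∈ s, u i) (∑ i ∈ s, v i) = ∑ i ∈ s, D (u i) (v i) := by
  rw [LinearMap.map_sum₂]
  refine Finset.sum_congr rfl fun i hi => ?_
  rw [map_sum]
  exact Finset.sum_eq_single_of_mem i hi fun j hj hji => hD _ _ (huv i hi j hj hji.symm)

end Bilinear

variable [CompactSpace X] {E : Type*} [NormedAddCommGroup E] [NormedSpace ℝ E]
  {D : C(X, ℝ) →ₗ[ℝ] C(X, ℝ) →ₗ[ℝ] E} {C : ℝ}

theorem norm_sum_apply_tent_succ_tent_le (hC : ∀ f g, ‖f‖ ≤ 1 → ‖g‖ ≤ 1 → ‖D f g‖ ≤ C)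
    (hD : ∀ f g, f * g = 0 → D f g = 0) (f : C(X, ℝ)) {s : Finset ℕ} {r : ℕ}
    (hs : ∀ k ∈ s, k % 3 = r) : ‖∑ k ∈ s, D (tent f (k + 1)) (tent f k)‖ ≤ C := by
  have orthogonal : ∀ i ∈ s, ∀ j ∈ s, i ≠ j → tent f (i + 1) * tent f j = 0 := by
    intro i hi j hj hij
    have hr : i % 3 = j % 3 := (hs i hi).trans (hs j hj).symm
    rcases lt_or_gt_of_ne hij with h | h
    · exact tent_mul_tent_eq_zero f (by omega)
    · rw [mul_comm]
      exact tent_mul_tent_eq_zero f (by omega)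
  have norm_shifted_le : ‖∑ k ∈ s, tent f (k + 1)‖ ≤ 1 := by
    simpa using norm_sum_tent_le_one f (s.map (addRightEmbedding 1))
  rw [← apply_sum_sum_of_mul_eq_zero hD s _ _ orthogonal]
  exact hC _ _ norm_shifted_le (norm_sum_tent_le_one f s)

theorem norm_apply_one_le_of_alternating (hC : ∀ f g, ‖f‖ ≤ 1 → ‖g‖ ≤ 1 → ‖D f g‖ ≤ C)
    (hD : ∀ f g, f * g = 0 → D f g = 0) (halt : ∀ f, D f f = 0) {f : C(X, ℝ)} (hf : 1 ≤ f) :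
    ‖D f 1‖ ≤ 3 * C := by
  obtain ⟨n, hn⟩ := exists_nat_ge ‖f‖
  have hfn : f ≤ ((n + 1 : ℕ) : C(X, ℝ)) := fun x => by
    simpa using (f.apply_le_norm x).trans (hn.trans (by linarith))
  have hsum : D f 1 = ∑ k ∈ Finset.range n, D (tent f (k + 1)) (tent f k) := by
    simp_rw [← apply_ramp_succ_one hD halt]
    rw [← LinearMap.map_sum₂, sum_ramp_succ hf hfn, LinearMap.map_sub₂, halt, sub_zero]
  rw [hsum, ← Finset.sum_fiberwise_of_maps_to (t := Finset.range 3) (g := (· % 3))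
    fun k _ => Finset.mem_range.2 (k.mod_lt three_pos)]
  simpa using norm_sum_le_of_le (Finset.range 3) fun r _ =>
    norm_sum_apply_tent_succ_tent_le hC hD f fun k hk => (Finset.mem_filter.1 hk).2

theorem apply_one_eq_zero_of_alternating (hC : ∀ f g, ‖f‖ ≤ 1 → ‖g‖ ≤ 1 → ‖D f g‖ ≤ C)
    (hD : ∀ f g, f * g = 0 → D f g = 0) (halt : ∀ f, D f f = 0) (f : C(X, ℝ)) : D f 1 = 0 := by
  have bounded (g : C(X, ℝ)) : ‖D g 1‖ ≤ 3 * C := by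
    have one_le : 1 ≤ g + (‖g‖ + 1) • (1 : C(X, ℝ)) := fun x => by
      suffices 1 ≤ g x + (‖g‖ + 1) by simpa using this
      linarith [g.neg_norm_le_apply x]
    simpa [halt] using norm_apply_one_le_of_alternating hC hD halt one_le
  by_contra hne
  obtain ⟨n, hn⟩ := exists_nat_gt (3 * C / ‖D f 1‖)
  rw [div_lt_iff₀ (norm_pos_iff.2 hne)] at hn
  have := bounded ((n : ℝ) • f)
  rw [LinearMap.map_smul₂, norm_smul, Real.norm_natCast] at this
  linarith

theorem apply_one_comm_of_mul_eq_zero (hC : ∀ f g, ‖f‖ ≤ 1 → ‖g‖ ≤ 1 → ‖D f g‖ ≤ C)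
    (hD : ∀ f g, f * g = 0 → D f g = 0) (f : C(X, ℝ)) : D f 1 = D 1 f := by
  have bounded (f g : C(X, ℝ)) (hf : ‖f‖ ≤ 1) (hg : ‖g‖ ≤ 1) : ‖(D - D.flip) f g‖ ≤ C + C :=
    norm_sub_le_of_le (hC f g hf hg) (hC g f hg hf)
  have disjoint (f g : C(X, ℝ)) (hfg : f * g = 0) : (D - D.flip) f g = 0 := by
    simp [hD f g hfg, hD g f (mul_comm f g ▸ hfg)]
  exact sub_eq_zero.1 (apply_one_eq_zero_of_alternating bounded disjoint (fun f => by simp) f)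

end ContinuousFunctions

section CStarAlgebras

variable {A E : Type*} [NonUnitalCStarAlgebra A] [NormedAddCommGroup E] [NormedSpace ℂ E]

theorem apply_one_comm_of_isSelfAdjoint {U : Type*} [CStarAlgebra U] {W : U →L[ℂ] U →L[ℂ] E}
    (hW : ∀ x y, x * y = 0 → W x y = 0) {h : U} (hh : IsSelfAdjoint h) : W h 1 = W 1 h := by
  let Φ : C(spectrum ℝ h, ℝ) →⋆ₐ[ℝ] U := cfcHom hh
  let D : C(spectrum ℝ h, ℝ) →ₗ[ℝ] C(spectrum ℝ h, ℝ) →ₗ[ℝ] E :=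
    (W.bilinearRestrictScalars ℝ).toLinearMap₁₂.compl₁₂ Φ.toAlgHom.toLinearMap
      Φ.toAlgHom.toLinearMap
  have D_apply (f g) : D f g = W (Φ f) (Φ g) := rfl
  have bounded (f g) (hf : ‖f‖ ≤ 1) (hg : ‖g‖ ≤ 1) : ‖D f g‖ ≤ ‖W‖ := by
    simpa [D_apply, Φ] using W.le_of_opNorm₂_le_of_le le_rfl ((norm_cfcHom h f hh).trans_le hf)
      ((norm_cfcHom h g hh).trans_le hg)
  have disjoint (f g) (hfg : f * g = 0) : D f g = 0 :=
    hW _ _ (by rw [← map_mul Φ, hfg, map_zero] : Φ f * Φ g = 0)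
  have := apply_one_comm_of_mul_eq_zero bounded disjoint (.restrict _ (.id ℝ))
  simpa [D_apply, Φ, cfcHom_id hh] using this

theorem apply_one_comm_of_zero_product {U : Type*} [CStarAlgebra U] {W : U →L[ℂ] U →L[ℂ] E}
    (hW : ∀ x y, x * y = 0 → W x y = 0) (u : U) : W u 1 = W 1 u := by
  rw [← realPart_add_I_smul_imaginaryPart u]
  simp only [map_add, map_smul, add_apply, smul_apply,
    apply_one_comm_of_isSelfAdjoint hW (realPart u).2,
    apply_one_comm_of_isSelfAdjoint hW (imaginaryPart u).2]

theorem apply_mul_assoc_of_zero_product {V : A →L[ℂ] A →L[ℂ] E}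
    (hV : ∀ a b, a * b = 0 → V a b = 0) (a b c : A) : V (a * b) c = V a (b * c) := by
  let snd : Unitization ℂ A →L[ℂ] A := ⟨Unitization.sndHom ℂ ℂ A, Unitization.continuous_snd⟩
  have coe_snd_mul (u : Unitization ℂ A) : (snd (a * u) : Unitization ℂ A) = a * u := by
    ext <;> simp [snd, Unitization.sndHom]
  have coe_snd_mul' (u : Unitization ℂ A) : (snd (u * c) : Unitization ℂ A) = u * c := by
    ext <;> simp [snd, Unitization.sndHom]
  let W : Unitization ℂ A →L[ℂ] Unitization ℂ A →L[ℂ] E :=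
    V.bilinearComp (snd ∘L .mul ℂ (Unitization ℂ A) a)
      (snd ∘L (ContinuousLinearMap.mul ℂ (Unitization ℂ A)).flip c)
  have W_apply (x y : Unitization ℂ A) : W x y = V (snd (a * x)) (snd (y * c)) := rfl
  have disjoint (x y : Unitization ℂ A) (hxy : x * y = 0) : W x y = 0 := by
    refine hV (snd (a * x)) (snd (y * c)) (Unitization.inr_injective (R := ℂ) ?_)
    rw [Unitization.inr_mul, coe_snd_mul, coe_snd_mul', mul_assoc, ← mul_assoc x, hxy, zero_mul,
      mul_zero, Unitization.inr_zero]
  have snd_coe (d : A) : snd d = d := Unitization.snd_inr ℂ d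
  simpa [W_apply, ← Unitization.inr_mul, snd_coe] using apply_one_comm_of_zero_product disjoint b

theorem exists_isApproximateUnit (A : Type*) [NonUnitalCStarAlgebra A] :
    ∃ l : Filter A, l.IsApproximateUnit := by
  let := CStarAlgebra.spectralOrder A
  have := CStarAlgebra.spectralOrderedRing A
  exact ⟨_, (CStarAlgebra.increasingApproximateUnit A).toIsApproximateUnit⟩

theorem sum_apply_eq_zero_of_forall_mul {ι : Type*} {s : Finset ι} {T : ι → A →L[ℂ] E} {x : ι → A}
    (h : ∀ e, ∑ k ∈ s, T k (x k * e) = 0) : ∑ k ∈ s, T k (x k) = 0 := by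
  obtain ⟨l, hl⟩ := exists_isApproximateUnit A
  have := hl.neBot
  have tendsto_sum : Tendsto (fun e => ∑ k ∈ s, T k (x k * e)) l (𝓝 (∑ k ∈ s, T k (x k))) :=
    tendsto_finsetSum _ fun k _ => ((T k).continuous.tendsto _).comp (hl.tendsto_mul_left (x k))
  exact tendsto_nhds_unique tendsto_sum (by simp only [h, tendsto_const_nhds])

theorem sum_apply_eq_zero_of_zero_product {V : A →L[ℂ] A →L[ℂ] E}
    (hV : ∀ a b, a * b = 0 → V a b = 0) {ι : Type*} {s : Finset ι} {x y : ι → A}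
    (hxy : ∑ k ∈ s, x k * y k = 0) : ∑ k ∈ s, V (x k) (y k) = 0 :=
  sum_apply_eq_zero_of_forall_mul fun e => by
    simp_rw [← apply_mul_assoc_of_zero_product hV]
    rw [← sum_apply, ← map_sum, hxy, map_zero, zero_apply]

theorem sum_apply_eq_zero_of_zero_triple_product {T : A →L[ℂ] A →L[ℂ] A →L[ℂ] E}
    (hT : ∀ a b c, a * b * c = 0 → T a b c = 0) {ι : Type*} {s : Finset ι} {x y z : ι → A}
    (hxyz : ∑ k ∈ s, x k * y k * z k = 0) : ∑ k ∈ s, T (x k) (y k) (z k) = 0 :=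
  sum_apply_eq_zero_of_forall_mul fun e => by
    have shift (k : ι) : T (x k) (y k) (z k * e) = T (x k) (y k * z k) e :=
      (apply_mul_assoc_of_zero_product
        (fun b c hbc => hT (x k) b c (by rw [mul_assoc, hbc, mul_zero])) _ _ _).symm
    simp_rw [shift]
    exact sum_apply_eq_zero_of_zero_product
      (V := (ContinuousLinearMap.compL ℂ A (A →L[ℂ] E) E (.apply ℂ E e)) ∘L T)
      (fun a b hab => hT a b e (by rw [hab, zero_mul])) (by simpa only [mul_assoc] using hxyz)

end CStarAlgebras

section Matrices

variable {A B l m n o : Type*} [NonUnitalCStarAlgebra A] [NonUnitalNormedRing B]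
  [NormedSpace ℂ B] [IsScalarTower ℂ B B] [SMulCommClass ℂ B B] [Fintype m] {φ ψ χ : A →L[ℂ] B}

theorem cstarMatrix_map_mul_map_eq_zero (h : ∀ a b, a * b = 0 → φ a * ψ b = 0)
    {M : CStarMatrix l m A} {N : CStarMatrix m n A} (hMN : M * N = 0) : M.map φ * N.map ψ = 0 := by
  ext i j
  rw [CStarMatrix.mul_apply]
  exact sum_apply_eq_zero_of_zero_product (V := (ContinuousLinearMap.mul ℂ B).bilinearComp φ ψ) h
    (congr_fun₂ hMN i j)

theorem cstarMatrix_map_mul_map_mul_map_eq_zero [Fintype n]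
    (h : ∀ a b c, a * b * c = 0 → φ a * ψ b * χ c = 0) {L : CStarMatrix l m A}
    {M : CStarMatrix m n A} {N : CStarMatrix n o A} (hLMN : L * M * N = 0) :
    L.map φ * M.map ψ * N.map χ = 0 := by
  let T : A →L[ℂ] A →L[ℂ] A →L[ℂ] B :=
    (ContinuousLinearMap.compL ℂ A B (A →L[ℂ] B)
      ((ContinuousLinearMap.mul ℂ B).bilinearComp (.id ℂ B) χ)) ∘L
        (ContinuousLinearMap.mul ℂ B).bilinearComp φ ψ
  ext i j
  have hij := congr_fun₂ hLMN i j
  simp only [CStarMatrix.mul_apply, Finset.sum_mul, ← Finset.sum_product'] at hij ⊢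
  exact sum_apply_eq_zero_of_zero_triple_product (T := T) h hij

end Matrices

open WithConv in
theorem corollary2p5_general {A B ι : Type*} [NonUnitalCStarAlgebra A] [NonUnitalNormedRing B]
    [StarRing B] [ContinuousStar B] [NormedSpace ℂ B] [IsScalarTower ℂ B B] [SMulCommClass ℂ B B]
    [StarModule ℂ B] [Fintype ι] (φ : A →L[ℂ] B) :
    (PreservesZeroProducts φ →
      PreservesZeroProducts fun M : CStarMatrix ι ι A => M.map φ) ∧
    (PreservesRangeOrthogonality φ →
      PreservesRangeOrthogonality fun M : CStarMatrix ι ι A => M.map φ) ∧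
    (PreservesDomainOrthogonality φ →
      PreservesDomainOrthogonality fun M : CStarMatrix ι ι A => M.map φ) ∧
    (PreservesZeroTROProducts φ →
      PreservesZeroTROProducts fun M : CStarMatrix ι ι A => M.map φ) := by
  let φ' : A →L[ℂ] B := (star (toConv φ)).ofConv
  have star_map (M : CStarMatrix ι ι A) : star (M.map φ) = (star M).map φ' := by
    ext i j
    simp [φ', CStarMatrix.star_apply]
  refine ⟨fun h M N hMN => cstarMatrix_map_mul_map_eq_zero h hMN, fun h M N hMN => ?_,
    fun h M N hMN => ?_, fun h L M N hLMN => ?_⟩ <;> simp only [star_map]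
  · exact cstarMatrix_map_mul_map_eq_zero (fun a b hab => h (star a) b (by rwa [star_star])) hMN
  · exact cstarMatrix_map_mul_map_eq_zero (fun a b hab => h a (star b) (by rwa [star_star])) hMN
  · exact cstarMatrix_map_mul_map_mul_map_eq_zero
      (fun a b c habc => h a (star b) c (by rwa [star_star])) hLMN

theorem corollary2p5 {A B : Type*} [NonUnitalCStarAlgebra A] [NonUnitalCStarAlgebra B]
    (φ : A →L[ℂ] B) :
    (PreservesZeroProducts φ → ∀ n : ℕ, 1 ≤ n → PreservesZeroProducts (amplification φ n)) ∧
    (PreservesRangeOrthogonality φ →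
      ∀ n : ℕ, 1 ≤ n → PreservesRangeOrthogonality (amplification φ n)) ∧
    (PreservesDomainOrthogonality φ →
      ∀ n : ℕ, 1 ≤ n → PreservesDomainOrthogonality (amplification φ n)) ∧
    (PreservesZeroTROProducts φ →
      ∀ n : ℕ, 1 ≤ n → PreservesZeroTROProducts (amplification φ n)) :=
  ⟨fun h _ _ => (corollary2p5_general φ).1 h, fun h _ _ => (corollary2p5_general φ).2.1 h,
    fun h _ _ => (corollary2p5_general φ).2.2.1 h, fun h _ _ => (corollary2p5_general φ).2.2.2 h⟩
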